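/- Let $1\le p<\infty$, let $(X,\mathcal B,\mu)$ be a $\sigma$-finite measure space, and let $f:X\to X$ be a bijection such that $f(B)\in\mathcal B$ and $f^{-1}(B)\in\mathcal B$ for every $B\in\mathcal B$, such that $\mu(f^{-1}(B))=0$ if and only if $\mu(B)=0$ for every $B\in\mathcal B$, and such that for some $c>0$ one has $\mu(f^{-1}(B))\le c\,\mu(B)$ for every $B\in\mathcal B$. Let $T_f:L^p(X)\to L^p(X)$, $T_f\varphi=\varphi\circ f$, be the (bounded) composition operator on the complex space $L^p(X)=L^p(X,\mathcal B,\mu)$. Suppose that there is $W\in\mathcal B$ with $0<\mu(W)<\infty$ such that the sets $f^k(W)$, $k\in\mathbb Z$, are pairwise disjoint and have union $X$ (dissipativity), and that there is $K>0$ such that $$\frac1K\,\mu(f^k(W))\,\mu(B)\le \mu(f^k(B))\,\mu(W)\le K\,\mu(f^k(W))\,\mu(B)$$ for all $k\in\mathbb Z$ and all $B\in\mathcal B$ with $B\subseteq W$ (bounded distortion). Let $B_w$ be the weighted backward shift $B_w(\{x_n\}_{n\in\mathbb Z})=\{w_{n+1}x_{n+1}\}_{n\in\mathbb Z}$ on the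 complex space $\ell^p(\mathbb Z)$ with the (bounded) weights $$w_k=\left(\frac{\mu(f^{k-1}(W))}{\mu(f^k(W))}\right)^{1/p},\qquad k\in\mathbb Z.$$ A bounded linear operator $T$ on a complex Banach space $E$ is called strongly structurally stable if it is invertible and for every $\gamma>0$ there is $\varepsilon>0$ such that for every bounded Lipschitz map $\phi:E\to E$ with $\|\phi\|_\infty\le\varepsilon$ and $\mathrm{Lip}(\phi)\le\varepsilon$ there is a homeomorphism $h:E\to E$ with $h\circ T=(T+\phi)\circ h$ and $\|h-I\|_\infty\le\gamma$. If $B_w$ is strongly structurally stable, then so is $T_f$. -/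

import Mathlib

open MeasureTheory Set Function
open scoped ENNReal NNReal BoundedContinuousFunction

noncomputable section

/-! Strong structural stability -/

/-- A bounded linear operator `T` on a complex Banach space is strongly structurally stable if it is
invertible and for every `γ > 0` there is `ε > 0` such that for each bounded Lipschitz map `φ` with
`‖φ‖_∞ ≤ ε` and `Lip φ ≤ ε` there is a homeomorphism `h` with `h ∘ T = (T + φ) ∘ h` and
`‖h - id‖_∞ ≤ γ`. -/
def StronglyStructurallyStable {E : Type*} [NormedAddCommGroup E] [NormedSpace ℂ E]
    (T : E →L[ℂ] E) : Prop :=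
  T.IsInvertible ∧
    ∀ γ : ℝ, 0 < γ → ∃ ε : ℝ≥0, 0 < ε ∧
      ∀ φ : E →ᵇ E, ‖φ‖ ≤ ε → LipschitzWith ε φ →
        ∃ h : E ≃ₜ E, (∀ x, h (T x) = T (h x) + φ (h x)) ∧ ∀ x, ‖h x - x‖ ≤ γ

/-! Bilateral weighted backward shifts -/

section Shift

variable (p : ℝ≥0∞)

theorem weightedShift_sum_le [Fact (1 ≤ p)] (hp : p ≠ ∞) (w : ℤ → ℂ) (C : ℝ)
    (hC : ∀ n, ‖w n‖ ≤ C) (x : lp (fun _ : ℤ => ℂ) p) (s : Finset ℤ) :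
    ∑ n ∈ s, ‖w (n + 1) * x (n + 1)‖ ^ p.toReal ≤ (C * ‖x‖) ^ p.toReal := by
  have hp1 : 1 ≤ p := Fact.out
  have hp0 : 0 < p.toReal := ENNReal.toReal_pos (by positivity) hp
  have hC0 : 0 ≤ C := (norm_nonneg _).trans (hC 0)
  have h := lp.sum_rpow_le_norm_rpow hp0 x (s.map (addRightEmbedding (1 : ℤ)))
  rw [Finset.sum_map] at h
  calc ∑ n ∈ s, ‖w (n + 1) * x (n + 1)‖ ^ p.toReal
      ≤ ∑ n ∈ s, C ^ p.toReal * ‖x (n + 1)‖ ^ p.toReal := by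
        refine Finset.sum_le_sum fun n _ => ?_
        rw [← Real.mul_rpow hC0 (norm_nonneg _), norm_mul]
        gcongr
        exact hC _
    _ ≤ C ^ p.toReal * ‖x‖ ^ p.toReal := by
        rw [← Finset.mul_sum]
        gcongr
        exact h
    _ = (C * ‖x‖) ^ p.toReal := (Real.mul_rpow hC0 (norm_nonneg _)).symm

theorem weightedShift_memℓp [Fact (1 ≤ p)] (hp : p ≠ ∞) (w : ℤ → ℂ)
    (hw : ∃ C : ℝ, ∀ n, ‖w n‖ ≤ C) (x : lp (fun _ : ℤ => ℂ) p) :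
    Memℓp (fun n : ℤ => w (n + 1) * x (n + 1)) p := by
  obtain ⟨C, hC⟩ := hw
  exact memℓp_gen' fun s => weightedShift_sum_le p hp w C hC x s

/-- The bilateral weighted backward shift `B_w` on `ℓ^p(ℤ)`, `(B_w x)_n = w_{n+1} x_{n+1}`,
for a bounded weight sequence `w`. -/
def weightedShift [Fact (1 ≤ p)] (hp : p ≠ ∞) (w : ℤ → ℂ) (hw : ∃ C : ℝ, ∀ n, ‖w n‖ ≤ C) :
    lp (fun _ : ℤ => ℂ) p →L[ℂ] lp (fun _ : ℤ => ℂ) p :=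
  LinearMap.mkContinuousOfExistsBound
    { toFun := fun x => ⟨fun n => w (n + 1) * x (n + 1), weightedShift_memℓp p hp w hw x⟩
      map_add' := fun x y => by
        ext n
        exact mul_add _ _ _
      map_smul' := fun a x => by
        ext n
        simp [mul_left_comm] }
    (by
      obtain ⟨C, hC⟩ := hw
      have hp1 : 1 ≤ p := Fact.out
      refine ⟨C, fun x => lp.norm_le_of_forall_sum_le (ENNReal.toReal_pos (by positivity) hp)
        (mul_nonneg ((norm_nonneg _).trans (hC 0)) (norm_nonneg x)) fun s => ?_⟩
      exact weightedShift_sum_le p hp w C hC x s)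

theorem weightedShift_apply [Fact (1 ≤ p)] (hp : p ≠ ∞) (w : ℤ → ℂ)
    (hw : ∃ C : ℝ, ∀ n, ‖w n‖ ≤ C) (x : lp (fun _ : ℤ => ℂ) p) (n : ℤ) :
    weightedShift p hp w hw x n = w (n + 1) * x (n + 1) := rfl

end Shift

/-! Composition operators -/

section Composition

variable {X : Type*} [MeasurableSpace X]

/-- The data of a composition dynamical system: a σ-finite measure and an injective bimeasurable
transformation `f` with `μ (f⁻¹ B) ≤ c μ B` for all measurable `B`, for some `c > 0`. -/
structure IsCompositionSystem (μ : Measure X) (f : X → X) : Prop where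
  sigmaFinite : SigmaFinite μ
  injective : Injective f
  measurable : Measurable f
  measurableSet_image : ∀ B, MeasurableSet B → MeasurableSet (f '' B)
  exists_bound : ∃ c : ℝ≥0, 0 < c ∧ ∀ B, MeasurableSet B → μ (f ⁻¹' B) ≤ c * μ B

theorem IsCompositionSystem.exists_map_le {μ : Measure X} {f : X → X}
    (h : IsCompositionSystem μ f) : ∃ c : ℝ≥0, μ.map f ≤ (c : ℝ≥0∞) • μ := by
  obtain ⟨c, -, hc⟩ := h.exists_bound
  refine ⟨c, Measure.le_iff.2 fun s hs => ?_⟩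
  rw [Measure.map_apply h.measurable hs]
  simpa using hc s hs

theorem IsCompositionSystem.quasiMeasurePreserving {μ : Measure X} {f : X → X}
    (h : IsCompositionSystem μ f) : Measure.QuasiMeasurePreserving f μ μ := by
  obtain ⟨c, hc⟩ := h.exists_map_le
  exact ⟨h.measurable, Measure.absolutelyContinuous_of_le_smul hc⟩

theorem IsCompositionSystem.memLp_comp {μ : Measure X} {f : X → X} (h : IsCompositionSystem μ f)
    {p : ℝ≥0∞} {g : X → ℂ} (hg : MemLp g p μ) : MemLp (g ∘ f) p μ := by
  obtain ⟨c, hc⟩ := h.exists_map_le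
  exact (hg.of_measure_le_smul ENNReal.coe_ne_top hc).comp_of_map h.measurable.aemeasurable

theorem IsCompositionSystem.exists_eLpNorm_comp_le {μ : Measure X} {f : X → X}
    (h : IsCompositionSystem μ f) (p : ℝ≥0∞) :
    ∃ C : ℝ≥0, ∀ g : X → ℂ, MemLp g p μ → eLpNorm (g ∘ f) p μ ≤ C * eLpNorm g p μ := by
  obtain ⟨c, hc⟩ := h.exists_map_le
  have hfin : (c : ℝ≥0∞) ^ (1 / p).toReal ≠ ∞ := by simp
  refine ⟨((c : ℝ≥0∞) ^ (1 / p).toReal).toNNReal, fun g hg => ?_⟩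
  rw [ENNReal.coe_toNNReal hfin, ← eLpNorm_map_measure
    (hg.1.mono_ac (Measure.absolutelyContinuous_of_le_smul hc)) h.measurable.aemeasurable]
  exact (eLpNorm_mono_measure g hc).trans (eLpNorm_smul_measure_le _ g p μ)

/-- The composition operator `T_f : φ ↦ φ ∘ f` on the complex space `L^p(μ)`. -/
def compositionOperator (p : ℝ≥0∞) [Fact (1 ≤ p)] {μ : Measure X} {f : X → X}
    (hf : IsCompositionSystem μ f) : Lp ℂ p μ →L[ℂ] Lp ℂ p μ :=
  LinearMap.mkContinuousOfExistsBound
    { toFun := fun g => (hf.memLp_comp (Lp.memLp g)).toLp (g ∘ f)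
      map_add' := fun g₁ g₂ => by
        rw [← MemLp.toLp_add, MemLp.toLp_eq_toLp_iff]
        exact hf.quasiMeasurePreserving.ae_eq_comp (Lp.coeFn_add g₁ g₂)
      map_smul' := fun a g => by
        rw [RingHom.id_apply, ← MemLp.toLp_const_smul, MemLp.toLp_eq_toLp_iff]
        exact hf.quasiMeasurePreserving.ae_eq_comp (Lp.coeFn_smul a g) }
    (by
      obtain ⟨C, hC⟩ := hf.exists_eLpNorm_comp_le p
      refine ⟨C, fun g => ?_⟩
      have hg := Lp.memLp g
      have := ENNReal.toReal_mono (ENNReal.mul_ne_top ENNReal.coe_ne_top hg.2.ne) (hC g hg)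
      rw [ENNReal.toReal_mul, ENNReal.coe_toReal] at this
      exact (Lp.norm_toLp _ (hf.memLp_comp hg)).trans_le this)

theorem compositionOperator_coeFn (p : ℝ≥0∞) [Fact (1 ≤ p)] {μ : Measure X} {f : X → X}
    (hf : IsCompositionSystem μ f) (g : Lp ℂ p μ) :
    compositionOperator p hf g =ᵐ[μ] g ∘ f :=
  MemLp.coeFn_toLp (hf.memLp_comp (Lp.memLp g))

/-! Dissipative systems and bounded distortion, for an invertible transformation `f` -/

/-- `(X, μ, f)` is a dissipative system generated by `W`. -/
structure IsDissipativeSystem (μ : Measure X) (f : Equiv.Perm X) (W : Set X) : Prop where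
  nonsingular : ∀ B, MeasurableSet B → (μ (f ⁻¹' B) = 0 ↔ μ B = 0)
  measurableSet : MeasurableSet W
  measure_pos : 0 < μ W
  measure_lt_top : μ W < ∞
  pairwise_disjoint : Pairwise (Disjoint on fun k : ℤ => (f ^ k) '' W)
  iUnion_eq : ⋃ k : ℤ, (f ^ k) '' W = univ

/-- Bounded distortion on `W`: for some `K > 0`, all `k ∈ ℤ` and all measurable `B ⊆ W`,
`K⁻¹ μ(f^k W) μ(B) ≤ μ(f^k B) μ(W) ≤ K μ(f^k W) μ(B)`. -/
def HasBoundedDistortion (μ : Measure X) (f : Equiv.Perm X) (W : Set X) : Prop :=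
  ∃ K : ℝ≥0, 0 < K ∧ ∀ (k : ℤ) (B : Set X), MeasurableSet B → B ⊆ W →
    (K : ℝ≥0∞)⁻¹ * μ ((f ^ k) '' W) * μ B ≤ μ ((f ^ k) '' B) * μ W ∧
    μ ((f ^ k) '' B) * μ W ≤ K * μ ((f ^ k) '' W) * μ B

/-- The weights `w_k = (μ(f^{k-1} W) / μ(f^k W))^{1/p}`. -/
def systemWeight (p : ℝ≥0∞) (μ : Measure X) (f : Equiv.Perm X) (W : Set X) (k : ℤ) : ℂ :=
  (((μ ((f ^ (k - 1)) '' W) / μ ((f ^ k) '' W)).toReal ^ (1 / p.toReal) : ℝ) : ℂ)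

theorem systemWeight_bounded (p : ℝ≥0∞) {μ : Measure X} {f : Equiv.Perm X} {W : Set X}
    (hf : IsCompositionSystem μ f) (hW : IsDissipativeSystem μ f W) :
    ∃ C : ℝ, ∀ k, ‖systemWeight p μ f W k‖ ≤ C := by
  obtain ⟨c, -, hc⟩ := hf.exists_bound
  refine ⟨(c : ℝ) ^ (1 / p.toReal), fun k => ?_⟩
  have hmeas : MeasurableSet ((f ^ k) '' W) := by
    have himg : ∀ n : ℕ, ∀ B, MeasurableSet B → MeasurableSet ((f ^ n) '' B) := by
      intro n
      induction n with
      | zero => intro B hB; simpa using hB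
      | succ n ih =>
        intro B hB
        rw [pow_succ', Equiv.Perm.coe_mul, image_comp]
        exact hf.measurableSet_image _ (ih B hB)
    have hpre : ∀ n : ℕ, Measurable (f ^ n) := by
      intro n
      rw [Equiv.Perm.coe_pow]
      exact hf.measurable.iterate n
    cases k with
    | ofNat n => simpa using himg n W hW.measurableSet
    | negSucc n =>
      rw [zpow_negSucc, Equiv.Perm.inv_def, Equiv.image_symm_eq_preimage]
      exact hpre (n + 1) hW.measurableSet
  have hset : (f ^ (k - 1)) '' W = f ⁻¹' ((f ^ k) '' W) := by
    have hk : f ^ (k - 1) = f⁻¹ * f ^ k := by rw [sub_eq_neg_add, zpow_add, zpow_neg_one]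
    rw [hk, Equiv.Perm.coe_mul, image_comp, Equiv.Perm.inv_def, Equiv.image_symm_eq_preimage]
  have hle : (μ ((f ^ (k - 1)) '' W) / μ ((f ^ k) '' W)).toReal ≤ c :=
    ENNReal.toReal_le_coe_of_le_coe (ENNReal.div_le_of_le_mul (hset ▸ hc _ hmeas))
  rw [systemWeight, Complex.norm_real, Real.norm_of_nonneg (by positivity)]
  gcongr

end Composition

end

/-! Everything is governed by the numbers `m k = μ (f^k W)`. Perturbing `B_w` by small constants
forces `1 - B_w` to be onto, so by the open mapping theorem the basis vectors `e_j` have preimages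
`y` bounded uniformly in `j`. The equation `(1 - B_w) y = e_j` makes `y_n` a constant multiple of
`m_n^{1/p}` for `n ≤ j` and for `n > j`, and the two constants differ by `m_j^{-1/p}`. One of them
is therefore large, and `m_j` dominates its left or its right tail sum
(`exists_tsum_le_of_surjective_one_sub`). Dominated tails decay geometrically, and ℤ splits into a
set `J` from which `m` decays to the left and a complement from which it decays to the right
(`exists_dichotomy_of_tsum_le`).

Bounded distortion carries these rates to all measurable subsets of the levels `f^j W`. If `P` is
restriction to the union of the levels in `J`, the norms of `T_f^k P` and `T_f^{-k} (1 - P)` decay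
geometrically. This is a generalized form of hyperbolicity: the cohomological equation `g ∘ S - T ∘
g = ψ` has a bounded solution given by an absolutely convergent series, and the Grobman–Hartman
argument goes through (`stronglyStructurallyStable_of_summable`). Invertibility of `T_f` comes from
that of `B_w`, which bounds the weights below. -/

/-! ### Grobman–Hartman conjugacies from a summable Green operator -/

section Conjugacy

variable {E : Type*} [NormedAddCommGroup E]

/-- The `n`-th iterate of a homeomorphism, as a bundled continuous map. -/
def iterateMap (S : E ≃ₜ E) (n : ℕ) : C(E, E) := ⟨S^[n], S.continuous.iterate n⟩

/-- The map `x ↦ φ (x + g x)`. -/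
def shiftComp (φ g : E →ᵇ E) : E →ᵇ E :=
  φ.compContinuous ⟨fun x => x + g x, by fun_prop⟩

@[simp]
theorem shiftComp_apply (φ g : E →ᵇ E) (x : E) : shiftComp φ g x = φ (x + g x) := rfl

theorem norm_shiftComp_sub_le {φ : E →ᵇ E} {ε : ℝ≥0} (hφ : LipschitzWith ε φ) (g₁ g₂ : E →ᵇ E) :
    ‖shiftComp φ g₁ - shiftComp φ g₂‖ ≤ ε * ‖g₁ - g₂‖ := by
  refine (BoundedContinuousFunction.norm_le (by positivity)).2 fun x => ?_
  refine (hφ.norm_sub_le _ _).trans ?_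
  change ε * ‖x + g₁ x - (x + g₂ x)‖ ≤ _
  rw [add_sub_add_left_eq_sub]
  exact mul_le_mul_of_nonneg_left ((g₁ - g₂).norm_coe_le_norm x) ε.2

theorem norm_shiftComp_le (φ g : E →ᵇ E) : ‖shiftComp φ g‖ ≤ ‖φ‖ :=
  (BoundedContinuousFunction.norm_le (norm_nonneg _)).2 fun _ => φ.norm_coe_le_norm _

variable [NormedSpace ℂ E]

/-- The bounded continuous map `x ↦ A (ψ (s x))`. -/
noncomputable def sandwich (A : E →L[ℂ] E) (ψ : E →ᵇ E) (s : C(E, E)) : E →ᵇ E :=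
  BoundedContinuousFunction.ofNormedAddCommGroup (fun x => A (ψ (s x))) (by fun_prop)
    (‖A‖ * ‖ψ‖) fun x => (A.le_opNorm _).trans
      (mul_le_mul_of_nonneg_left (ψ.norm_coe_le_norm _) (norm_nonneg A))

theorem norm_sandwich_le (A : E →L[ℂ] E) (ψ : E →ᵇ E) (s : C(E, E)) :
    ‖sandwich A ψ s‖ ≤ ‖A‖ * ‖ψ‖ :=
  BoundedContinuousFunction.norm_ofNormedAddCommGroup_le _ (by positivity) _

/-- The operator `ψ ↦ ∑ₖ (Aₖ ∘ ψ ∘ S⁻⁽ᵏ⁺¹⁾ - Bₖ ∘ ψ ∘ Sᵏ)` on bounded continuous maps. -/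
noncomputable def greenOperator (A B : ℕ → E →L[ℂ] E) (S : E ≃ₜ E) (ψ : E →ᵇ E) : E →ᵇ E :=
  ∑' k, (sandwich (A k) ψ (iterateMap S.symm (k + 1)) - sandwich (B k) ψ (iterateMap S k))

variable {A B : ℕ → E →L[ℂ] E}

theorem norm_greenTerm_le (S : E ≃ₜ E) (ψ : E →ᵇ E) (k : ℕ) :
    ‖sandwich (A k) ψ (iterateMap S.symm (k + 1)) - sandwich (B k) ψ (iterateMap S k)‖
      ≤ (‖A k‖ + ‖B k‖) * ‖ψ‖ := by
  rw [add_mul]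
  exact (norm_sub_le _ _).trans (add_le_add (norm_sandwich_le _ _ _) (norm_sandwich_le _ _ _))

theorem norm_greenOperator_le (hA : Summable fun k => ‖A k‖) (hB : Summable fun k => ‖B k‖)
    (S : E ≃ₜ E) (ψ : E →ᵇ E) :
    ‖greenOperator A B S ψ‖ ≤ (∑' k, (‖A k‖ + ‖B k‖)) * ‖ψ‖ := by
  rw [← tsum_mul_right]
  exact tsum_of_norm_bounded ((hA.add hB).mul_right ‖ψ‖).hasSum (norm_greenTerm_le S ψ)

variable [CompleteSpace E]

theorem summable_greenTerm (hA : Summable fun k => ‖A k‖) (hB : Summable fun k => ‖B k‖)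
    (S : E ≃ₜ E) (ψ : E →ᵇ E) :
    Summable fun k => sandwich (A k) ψ (iterateMap S.symm (k + 1)) -
      sandwich (B k) ψ (iterateMap S k) :=
  .of_norm_bounded ((hA.add hB).mul_right ‖ψ‖) (norm_greenTerm_le S ψ)

theorem hasSum_greenOperator_apply (hA : Summable fun k => ‖A k‖)
    (hB : Summable fun k => ‖B k‖) (S : E ≃ₜ E) (ψ : E →ᵇ E) (x : E) :
    HasSum (fun k => A k (ψ (S.symm^[k + 1] x)) - B k (ψ (S^[k] x)))
      (greenOperator A B S ψ x) :=
  (summable_greenTerm hA hB S ψ).hasSum.map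
    (BoundedContinuousFunction.evalCLM ℂ x : (E →ᵇ E) →L[ℂ] E)
    (BoundedContinuousFunction.evalCLM ℂ x : (E →ᵇ E) →L[ℂ] E).continuous

theorem greenOperator_sub (hA : Summable fun k => ‖A k‖) (hB : Summable fun k => ‖B k‖)
    (S : E ≃ₜ E) (ψ₁ ψ₂ : E →ᵇ E) :
    greenOperator A B S (ψ₁ - ψ₂) = greenOperator A B S ψ₁ - greenOperator A B S ψ₂ := by
  ext x
  refine (hasSum_greenOperator_apply hA hB S _ x).unique ?_
  refine ((hasSum_greenOperator_apply hA hB S ψ₁ x).sub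
    (hasSum_greenOperator_apply hA hB S ψ₂ x)).congr_fun ?_
  intro k
  simp only [BoundedContinuousFunction.coe_sub, Pi.sub_apply, map_sub]
  abel

/-- The series sees its base point only through the orbit, and `h` carries `S`-orbits to `S'`-orbits
in both time directions. This compares the Green operators of `T` and of `T + φ`. -/
theorem greenOperator_comp_of_semiconj (hA : Summable fun k => ‖A k‖)
    (hB : Summable fun k => ‖B k‖) {S S' : E ≃ₜ E} {h : E → E}
    (hS : Semiconj h S S') {ψ ψ' : E →ᵇ E} (hψ : ∀ x, ψ' x = ψ (h x)) (x : E) :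
    greenOperator A B S' ψ (h x) = greenOperator A B S ψ' x := by
  refine (hasSum_greenOperator_apply hA hB S' ψ (h x)).unique ?_
  convert hasSum_greenOperator_apply hA hB S ψ' x using 3 with k
  · have hs : Semiconj h S.symm S'.symm := fun y => by
      rw [Homeomorph.eq_symm_apply, ← hS.eq, Homeomorph.apply_symm_apply]
    rw [hψ, (hs.iterate_right (k + 1)).eq]
  · rw [hψ, (hS.iterate_right k).eq]

/-- Telescoping: moving from `x` to `S x` shifts both series by one index, as does applying `T`. The
two boundary terms add up to `ψ x` by `h1`. Here `S` may be nonlinear and unrelated to `T`. -/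
theorem greenOperator_apply_map (hA : Summable fun k => ‖A k‖)
    (hB : Summable fun k => ‖B k‖) {T : E →L[ℂ] E} (hTA : ∀ k, T ∘L A k = A (k + 1))
    (hTB : ∀ k, T ∘L B (k + 1) = B k) (h1 : A 0 + T ∘L B 0 = 1)
    (S : E ≃ₜ E) (ψ : E →ᵇ E) (x : E) :
    greenOperator A B S ψ (S x) = T (greenOperator A B S ψ x) + ψ x := by
  have bd (C : ℕ → E →L[ℂ] E) (hC : Summable fun k => ‖C k‖) (u : ℕ → E) :
      Summable fun k => C k (ψ (u k)) :=
    .of_norm_bounded (hC.mul_right ‖ψ‖) fun k => ((C k).le_opNorm _).trans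
      (mul_le_mul_of_nonneg_left (ψ.norm_coe_le_norm _) (norm_nonneg _))
  have e1 : greenOperator A B S ψ (S x) =
      ∑' k, A k (ψ (S.symm^[k] x)) - ∑' k, B k (ψ (S^[k + 1] x)) := by
    refine (hasSum_greenOperator_apply hA hB S ψ (S x)).unique ?_
    simp only [iterate_succ, comp_apply, Homeomorph.symm_apply_apply]
    exact (bd A hA _).hasSum.sub (bd B hB _).hasSum
  have e2 : greenOperator A B S ψ x =
      ∑' k, A k (ψ (S.symm^[k + 1] x)) - ∑' k, B k (ψ (S^[k] x)) :=
    (hasSum_greenOperator_apply hA hB S ψ x).unique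
      ((bd A hA _).hasSum.sub (bd B hB _).hasSum)
  have e3 : ∀ y, T (B 0 y) = y - A 0 y := fun y => by
    rw [eq_sub_iff_add_eq', ← ContinuousLinearMap.comp_apply, ← _root_.add_apply, h1]
    rfl
  rw [e1, e2, map_sub, T.map_tsum (bd A hA _), T.map_tsum (bd B hB _),
    (bd A hA _).tsum_eq_zero_add]
  have s2 : Summable fun k => T (B k (ψ (S^[k] x))) := (bd B hB _).mapL T
  rw [s2.tsum_eq_zero_add]
  simp only [← ContinuousLinearMap.comp_apply T, hTA, hTB]
  simp only [ContinuousLinearMap.comp_apply, e3, iterate_zero, id]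
  abel

theorem exists_greenOperator_fixedPoint (hA : Summable fun k => ‖A k‖)
    (hB : Summable fun k => ‖B k‖) (S : E ≃ₜ E) {φ : E →ᵇ E} {ε : ℝ≥0} (hφ : LipschitzWith ε φ)
    (hε : (∑' k, (‖A k‖ + ‖B k‖)) * ε < 1) :
    ∃ g : E →ᵇ E, greenOperator A B S (shiftComp φ g) = g := by
  have hM : 0 ≤ ∑' k, (‖A k‖ + ‖B k‖) := tsum_nonneg fun k => by positivity
  have hc : ContractingWith ((∑' k, (‖A k‖ + ‖B k‖)).toNNReal * ε)
      fun g => greenOperator A B S (shiftComp φ g) := by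
    refine ⟨by rwa [← NNReal.coe_lt_one, NNReal.coe_mul, Real.coe_toNNReal _ hM],
      LipschitzWith.of_dist_le_mul fun g₁ g₂ => ?_⟩
    rw [dist_eq_norm, dist_eq_norm, ← greenOperator_sub hA hB]
    refine (norm_greenOperator_le hA hB S _).trans ?_
    rw [NNReal.coe_mul, Real.coe_toNNReal _ hM, mul_assoc]
    exact mul_le_mul_of_nonneg_left (norm_shiftComp_sub_le hφ g₁ g₂) hM
  exact ⟨_, hc.fixedPoint_isFixedPt⟩

/-- A Grobman–Hartman theorem: an invertible operator for which the equation
`g ∘ T - T ∘ g = ψ` is solved by an absolutely convergent series is strongly structurally stable. -/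
theorem stronglyStructurallyStable_of_summable (hA : Summable fun k => ‖A k‖)
    (hB : Summable fun k => ‖B k‖) (T : E ≃L[ℂ] E)
    (hTA : ∀ k, (T : E →L[ℂ] E) ∘L A k = A (k + 1))
    (hTB : ∀ k, (T : E →L[ℂ] E) ∘L B (k + 1) = B k)
    (h1 : A 0 + (T : E →L[ℂ] E) ∘L B 0 = 1) :
    StronglyStructurallyStable (T : E →L[ℂ] E) := by
  refine ⟨⟨T, rfl⟩, fun γ hγ => ?_⟩
  set M : ℝ := ∑' k, (‖A k‖ + ‖B k‖)
  have hM : 0 ≤ M := tsum_nonneg fun k => by positivity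
  set N : ℝ := ‖(T.symm : E →L[ℂ] E)‖
  have hN : 0 ≤ N := norm_nonneg _
  -- Three smallness conditions at once: `M ε < 1` for the contraction, `M ε < γ` for the size of `h
  -- - id`, and `N ε < 1` for `T + φ` to be a homeomorphism. The summand `1` keeps the denominator
  -- positive.
  obtain ⟨ε, hε0, hε1⟩ : ∃ ε : ℝ≥0, 0 < (ε : ℝ) ∧ ε * (M + N + 1) < min γ 1 := by
    have hpos : 0 < min γ 1 / 2 / (M + N + 1) := by positivity
    refine ⟨(min γ 1 / 2 / (M + N + 1)).toNNReal, ?_, ?_⟩ <;> rw [Real.coe_toNNReal _ hpos.le]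
    · exact hpos
    rw [div_mul_cancel₀ _ (by positivity)]
    exact half_lt_self (by positivity)
  have hεM : M * ε < min γ 1 := by nlinarith
  have hεN : ε * N < 1 := by nlinarith [min_le_right γ 1]
  refine ⟨ε, hε0, fun φ hφn hφ => ?_⟩
  have hlin : ApproximatesLinearOn (fun x => T x + φ x) (T : E →L[ℂ] E) univ ε := by
    intro x _ y _
    have := hφ.norm_sub_le x y
    simpa [add_sub_add_comm, map_sub] using this
  have hcond : Subsingleton E ∨ ε < ‖(T.symm : E →L[ℂ] E)‖₊⁻¹ := by
    rcases subsingleton_or_nontrivial E with h | h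
    · exact Or.inl h
    · right
      have hpos : 0 < ‖(T.symm : E →L[ℂ] E)‖₊ := T.symm.norm_pos
      rw [← one_div, lt_div_iff₀ hpos]
      exact_mod_cast hεN
  let S : E ≃ₜ E := hlin.toHomeomorph _ hcond
  have hS : ∀ x, S x = T x + φ x := fun x => rfl
  obtain ⟨g, hg⟩ := exists_greenOperator_fixedPoint hA hB T.toHomeomorph hφ
    (show M * ε < 1 from hεM.trans_le (min_le_right _ _))
  set h : E → E := fun x => x + g x with hh
  have hconj : Semiconj h T.toHomeomorph S := fun x => by
    have := greenOperator_apply_map hA hB hTA hTB h1 T.toHomeomorph (shiftComp φ g) x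
    rw [hg] at this
    change T x + g (T x) = T (x + g x) + φ (x + g x)
    change g (T x) = T (g x) + φ (x + g x) at this
    rw [this, T.map_add, add_assoc]
  -- The inverse conjugacy needs no fixed point: with the orbits of `S = T + φ` in the series, it is
  -- explicit.
  set g' : E →ᵇ E := greenOperator A B S φ with hg'
  set k : E → E := fun x => x - g' x
  have hconj' : Semiconj k S T.toHomeomorph := fun x => by
    have := greenOperator_apply_map hA hB hTA hTB h1 S φ x
    change S x - g' (S x) = T (x - g' x)
    rw [hg', this, hS, map_sub]
    abel
  have hleft : LeftInverse k h := fun x => by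
    have : g' (h x) = g x := by
      conv_rhs => rw [← hg]
      exact greenOperator_comp_of_semiconj hA hB hconj (fun _ => rfl) x
    change h x - g' (h x) = x
    rw [this, hh, add_sub_cancel_right]
  -- The displacement `u` of `h ∘ k` satisfies a contractive equation over `S` that also has the
  -- solution `0`, hence `u = 0`.
  have hright : RightInverse k h := by
    have kc : Continuous k := by fun_prop
    let u : E →ᵇ E := g.compContinuous ⟨k, kc⟩ - g'
    have hu : ∀ x, h (k x) = x + u x := fun x => by
      change x - g' x + g (k x) = x + (g (k x) - g' x)
      abel
    have hgk : ∀ x, g (k x) = greenOperator A B S (shiftComp φ u) x := fun x => by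
      conv_lhs => rw [← hg]
      refine greenOperator_comp_of_semiconj hA hB hconj' (fun y => ?_) x
      rw [shiftComp_apply, shiftComp_apply, ← hu]
    have hu0 : u = greenOperator A B S (shiftComp φ u - shiftComp φ 0) := by
      rw [greenOperator_sub hA hB]
      ext x
      have e0 : shiftComp φ 0 = φ := by ext y; simp
      rw [e0]
      exact congrArg (· - g' x) (hgk x)
    have hnorm : ‖u‖ ≤ M * ε * ‖u‖ := by
      conv_lhs => rw [hu0]
      refine (norm_greenOperator_le hA hB S _).trans ?_
      rw [mul_assoc]
      refine mul_le_mul_of_nonneg_left ?_ hM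
      simpa using norm_shiftComp_sub_le hφ u 0
    have hu1 : ‖u‖ ≤ 0 := by
      nlinarith [norm_nonneg u, hεM.trans_le (min_le_right γ 1)]
    intro x
    rw [hu, norm_le_zero_iff.1 hu1]
    simp
  refine ⟨⟨⟨h, k, hleft, hright⟩, by fun_prop, by fun_prop⟩, fun x => ?_, fun x => ?_⟩
  · exact (hconj x).trans (hS _)
  · change ‖x + g x - x‖ ≤ γ
    rw [add_sub_cancel_left]
    refine (g.norm_coe_le_norm x).trans ?_
    rw [← hg]
    refine (norm_greenOperator_le hA hB _ _).trans ?_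
    calc M * ‖shiftComp φ g‖ ≤ M * ε :=
          mul_le_mul_of_nonneg_left ((norm_shiftComp_le φ g).trans hφn) hM
      _ ≤ γ := hεM.le.trans (min_le_left _ _)

/-- Perturbing by constant maps shows that `1 - T` is onto. -/
theorem StronglyStructurallyStable.surjective_one_sub {F : Type*} [NormedAddCommGroup F]
    [NormedSpace ℂ F] {T : F →L[ℂ] F} (hT : StronglyStructurallyStable T) :
    Surjective (1 - T : F →L[ℂ] F) := by
  obtain ⟨ε, hε, H⟩ := hT.2 1 one_pos
  intro z
  set r : ℝ := ε / (‖z‖ + 1) with hr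
  have hr0 : 0 < r := by positivity
  have hrz : ‖(r : ℂ) • z‖ ≤ ε := by
    rw [norm_smul, Complex.norm_real, Real.norm_of_nonneg hr0.le, hr, div_mul_eq_mul_div,
      div_le_iff₀ (by positivity)]
    exact mul_le_mul_of_nonneg_left (by linarith) ε.2
  obtain ⟨h, hh, -⟩ := H (BoundedContinuousFunction.const F ((r : ℂ) • z))
    ((BoundedContinuousFunction.norm_const_le _).trans hrz)
    ((LipschitzWith.const _).weaken zero_le)
  -- Since `T` fixes `0`, the point `h 0` is fixed by `T + r z`; dividing by `r` gives a preimage of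
  -- `z`.
  have h0 := hh 0
  rw [map_zero, BoundedContinuousFunction.const_apply] at h0
  refine ⟨(r : ℂ)⁻¹ • h 0, ?_⟩
  rw [map_smul, inv_smul_eq_iff₀ (by exact_mod_cast hr0.ne')]
  exact sub_eq_of_eq_add' h0

end Conjugacy

/-! ### Tail sums and geometric decay -/

section TailSums

/-- A positive sequence dominating its own tail sums decays geometrically. -/
theorem exists_geometric_bound_of_tsum_le (D : ℝ≥0) :
    ∃ C θ : ℝ≥0, θ < 1 ∧ ∀ a : ℕ → ℝ≥0∞, a 0 ≠ ∞ →
      (∀ k, ∑' n, a (n + k) ≤ D * a k) → ∀ k, a k ≤ (C * θ ^ k : ℝ≥0) * a 0 := by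
  refine ⟨D, D / (D + 1), (div_lt_one (by positivity)).2 (lt_add_one D), fun a h0 ha => ?_⟩
  -- Removing the first term of a tail removes a definite proportion of it. The ratio `D / (D + 1)`
  -- avoids subtraction and needs no lower bound on `D`.
  have key : ∀ k, ∑' n, a (n + (k + 1)) ≤ (D / (D + 1) : ℝ≥0) * ∑' n, a (n + k) := by
    intro k
    have h1 : ∑' n, a (n + k) = a k + ∑' n, a (n + (k + 1)) := by
      rw [tsum_eq_zero_add' ENNReal.summable, zero_add]
      exact congrArg (a k + ·) (tsum_congr fun n => congrArg a (by ring))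
    have h2 : ((D + 1 : ℝ≥0) : ℝ≥0∞) * ∑' n, a (n + (k + 1)) ≤ D * ∑' n, a (n + k) := by
      rw [ENNReal.coe_add, add_mul, ENNReal.coe_one, one_mul]
      calc _ ≤ D * ∑' n, a (n + (k + 1)) + ∑' n, a (n + k) := by
            refine add_le_add le_rfl ?_
            rw [h1]
            exact le_add_self
        _ ≤ D * ∑' n, a (n + (k + 1)) + D * a k := by
            gcongr
            exact ha k
        _ = _ := by rw [h1, mul_add, add_comm]
    rw [ENNReal.coe_div (by positivity), ← ENNReal.mul_div_right_comm]
    rw [ENNReal.le_div_iff_mul_le (Or.inl (by simp)) (Or.inl (by simp)), mul_comm]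
    exact h2
  have hS : ∀ k, ∑' n, a (n + k) ≤ ((D / (D + 1)) ^ k : ℝ≥0) * ∑' n, a n := by
    intro k
    induction k with
    | zero => simp
    | succ k ih =>
      refine (key k).trans ?_
      rw [pow_succ', ENNReal.coe_mul, mul_assoc]
      gcongr
  intro k
  calc a k ≤ ∑' n, a (n + k) := by simpa using ENNReal.le_tsum (f := fun n => a (n + k)) 0
    _ ≤ ((D / (D + 1)) ^ k : ℝ≥0) * ∑' n, a n := hS k
    _ ≤ ((D / (D + 1)) ^ k : ℝ≥0) * (D * a 0) := by
        gcongr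
        exact ha 0
    _ = _ := by
        rw [← mul_assoc, ← ENNReal.coe_mul, mul_comm D]

/-- If every entry of a bilateral sequence dominates its left or its right tail sum, then the
indices split into two classes with geometric decay to the left, respectively to the right. -/
theorem exists_dichotomy_of_tsum_le {m : ℤ → ℝ≥0∞} (hm : ∀ j, m j ≠ ∞) {C : ℝ≥0}
    (h : ∀ j, ∑' n : ℕ, m (j - n) ≤ C * m j ∨ ∑' n : ℕ, m (j + n) ≤ C * m j) :
    ∃ (J : Set ℤ) (D θ : ℝ≥0), θ < 1 ∧
      (∀ j ∈ J, ∀ k : ℕ, m (j - k) ≤ (D * θ ^ k : ℝ≥0) * m j) ∧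
      (∀ j ∉ J, ∀ k : ℕ, m (j + k) ≤ (D * θ ^ k : ℝ≥0) * m j) := by
  -- If left domination fails at `i` even with the larger constant, right domination holds at `i`,
  -- so `m j ≤ C * m i` for `j ≥ i`. Left domination at `j` would then give it at `i` with constant
  -- `C * C`.
  have step : ∀ i j : ℤ, i ≤ j → ¬ ∑' n : ℕ, m (i - n) ≤ (C * C + C : ℝ≥0) * m i →
      ∑' n : ℕ, m (j + n) ≤ C * m j := by
    intro i j hij hi
    refine (h j).resolve_left fun hj => hi ?_
    have hR : ∑' n : ℕ, m (i + n) ≤ C * m i := by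
      refine (h i).resolve_left fun hl => hi (hl.trans ?_)
      gcongr
      exact le_add_self
    obtain ⟨l, rfl⟩ := Int.exists_add_of_le hij
    calc ∑' n : ℕ, m (i - n) = ∑' n : ℕ, m (i + l - ((n + l : ℕ) : ℤ)) := by
          refine tsum_congr fun n => congrArg m ?_
          push_cast
          ring
      _ ≤ ∑' n : ℕ, m (i + l - n) :=
          ENNReal.tsum_comp_le_tsum_of_injective (add_left_injective l)
            fun n : ℕ => m (i + l - n)
      _ ≤ C * m (i + l) := hj
      _ ≤ C * (C * m i) := by
          gcongr
          exact (ENNReal.le_tsum (f := fun n : ℕ => m (i + n)) l).trans hR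
      _ ≤ _ := by
          rw [← mul_assoc, ← ENNReal.coe_mul]
          gcongr
          exact le_self_add
  obtain ⟨D, θ, hθ, hdec⟩ := exists_geometric_bound_of_tsum_le (C * C + C)
  -- Geometric decay from `j` needs domination at every index on that side of `j`. The quantifier
  -- over `i ≤ j` provides it inside the set, `step` outside.
  refine ⟨{j | ∀ i ≤ j, ∑' n : ℕ, m (i - n) ≤ (C * C + C : ℝ≥0) * m i}, D, θ, hθ, ?_, ?_⟩
  · intro j hj k
    have := hdec (fun n => m (j - n)) (hm _) (fun k => ?_) k
    · simpa using this
    · refine le_trans (le_of_eq (tsum_congr fun n => congrArg m ?_)) (hj (j - k) (by simp))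
      push_cast
      ring
  · intro j hj k
    simp only [mem_ofPred_eq, not_forall] at hj
    obtain ⟨i, hij, hi⟩ := hj
    have := hdec (fun n => m (j + n)) (hm _) (fun k => ?_) k
    · simpa using this
    · refine le_trans (le_of_eq (tsum_congr fun n => congrArg m ?_))
        ((step i (j + k) (by linarith [Int.natCast_nonneg k]) hi).trans ?_)
      · push_cast
        ring
      · gcongr
        exact le_add_self

end TailSums

/-! ### What stability of the shift says about the weights -/

section ShiftEstimates

variable {p : ℝ≥0∞} [Fact (1 ≤ p)]

/-- The weights of an invertible weighted shift are bounded away from zero. -/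
theorem exists_one_le_mul_norm_weight (hp : p ≠ ∞) {w : ℤ → ℂ} (hw : ∃ C : ℝ, ∀ n, ‖w n‖ ≤ C)
    (h : (weightedShift p hp w hw).IsInvertible) : ∃ N : ℝ, ∀ k, 1 ≤ N * ‖w k‖ := by
  obtain ⟨e, he⟩ := h
  have hp0 : 0 < p := zero_lt_one.trans_le Fact.out
  refine ⟨‖(e.symm : lp (fun _ : ℤ => ℂ) p →L[ℂ] lp (fun _ : ℤ => ℂ) p)‖, fun k => ?_⟩
  have h1 : e (lp.single p k (1 : ℂ)) = lp.single p (k - 1) (w k) := by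
    change (e : lp (fun _ : ℤ => ℂ) p →L[ℂ] lp (fun _ : ℤ => ℂ) p) _ = _
    rw [he]
    ext n
    rw [weightedShift_apply]
    by_cases hn : n = k - 1
    · subst hn
      rw [lp.single_apply_self, sub_add_cancel, lp.single_apply_self, mul_one]
    · rw [lp.single_apply_ne _ _ _ hn, lp.single_apply_ne _ _ _ (by omega), mul_zero]
  have h2 := (e.symm : lp (fun _ : ℤ => ℂ) p →L[ℂ] lp (fun _ : ℤ => ℂ) p).le_opNorm
    (lp.single p (k - 1) (w k))
  rw [lp.norm_single hp0, ContinuousLinearEquiv.coe_coe, ← h1, e.symm_apply_apply,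
    lp.norm_single hp0, norm_one] at h2
  exact h2

/-- The `ℓ^p` norm of `y` bounds `|c|^p` times the sum of the `m (e n)`, and `hj` bounds `|c|^p`
below by a multiple of `1 / m j`. -/
theorem tsum_le_of_norm_le_of_const_ratio (hp : p ≠ ∞) {m : ℤ → ℝ≥0}
    {y : lp (fun _ : ℤ => ℂ) p} {C : ℝ≥0} (hy : ‖y‖ ≤ C) {e : ℕ → ℤ} (he : Injective e) {c : ℂ}
    (hc : ∀ n, y (e n) = ((m (e n) : ℝ) ^ (1 / p.toReal) : ℝ) * c) {j : ℤ}
    (hj : 1 ≤ 2 * ((m j : ℝ) ^ (1 / p.toReal) * ‖c‖)) :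
    ∑' n, (m (e n) : ℝ≥0∞) ≤ ((2 * C) ^ p.toReal : ℝ≥0) * m j := by
  have hp1 : 1 ≤ p := Fact.out
  have hp0 : 0 < p.toReal := ENNReal.toReal_pos (by positivity) hp
  have hpow : ∀ i, ((m i : ℝ) ^ (1 / p.toReal)) ^ p.toReal = m i := fun i => by
    rw [one_div, Real.rpow_inv_rpow (m i).coe_nonneg hp0.ne']
  have h1 : 1 ≤ 2 ^ p.toReal * (m j * ‖c‖ ^ p.toReal) := by
    have := Real.one_le_rpow hj hp0.le
    rwa [Real.mul_rpow two_pos.le (by positivity), Real.mul_rpow (by positivity) (norm_nonneg c),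
      hpow] at this
  rw [ENNReal.tsum_eq_iSup_sum]
  refine iSup_le fun s => ?_
  have h2 := lp.sum_rpow_le_norm_rpow hp0 y (s.map ⟨e, he⟩)
  simp only [Finset.sum_map, Embedding.coeFn_mk, hc, norm_mul, Complex.norm_real] at h2
  have h3 : (∑ n ∈ s, (m (e n) : ℝ)) * ‖c‖ ^ p.toReal ≤ C ^ p.toReal := by
    refine le_trans (le_of_eq ?_) (h2.trans (Real.rpow_le_rpow (norm_nonneg y) hy hp0.le))
    rw [Finset.sum_mul]
    refine Finset.sum_congr rfl fun n _ => ?_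
    rw [Real.mul_rpow (norm_nonneg _) (norm_nonneg c), Real.norm_of_nonneg (by positivity), hpow]
  have h4 : ∑ n ∈ s, m (e n) ≤ (2 * C) ^ p.toReal * m j := by
    rw [← NNReal.coe_le_coe]
    push_cast
    rw [Real.mul_rpow two_pos.le C.coe_nonneg]
    calc ∑ n ∈ s, (m (e n) : ℝ)
        ≤ (∑ n ∈ s, (m (e n) : ℝ)) * (2 ^ p.toReal * (m j * ‖c‖ ^ p.toReal)) :=
          le_mul_of_one_le_right (Finset.sum_nonneg fun n _ => (m (e n)).coe_nonneg) h1
      _ = 2 ^ p.toReal * m j * ((∑ n ∈ s, (m (e n) : ℝ)) * ‖c‖ ^ p.toReal) := by ring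
      _ ≤ 2 ^ p.toReal * m j * C ^ p.toReal := by gcongr
      _ = _ := by ring
  exact_mod_cast h4

/-- If `1 - B_w` is onto, where `w_k = (m_{k-1} / m_k)^{1/p}`, then every `m_j` dominates its left
or its right tail sum. -/
theorem exists_tsum_le_of_surjective_one_sub (hp : p ≠ ∞) {w : ℤ → ℂ}
    (hw : ∃ C : ℝ, ∀ n, ‖w n‖ ≤ C) {m : ℤ → ℝ≥0} (hm : ∀ k, 0 < m k)
    (hwm : ∀ k, w k = (((m (k - 1) : ℝ) / m k) ^ (1 / p.toReal) : ℝ))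
    (h : Surjective (1 - weightedShift p hp w hw :
      lp (fun _ : ℤ => ℂ) p →L[ℂ] lp (fun _ : ℤ => ℂ) p)) :
    ∃ C : ℝ≥0, ∀ j, ∑' n : ℕ, (m (j - n) : ℝ≥0∞) ≤ C * m j ∨
      ∑' n : ℕ, (m (j + n) : ℝ≥0∞) ≤ C * m j := by
  have hp0 : 0 < p := zero_lt_one.trans_le Fact.out
  obtain ⟨C, hC0, hC⟩ := ContinuousLinearMap.exists_preimage_norm_le _ h
  -- Formally `v` is fixed by `B_w`. Writing `y = v u` turns `(1 - B_w) y = e_j` into a difference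
  -- equation for `u`, whose only jump is between `j` and `j + 1`.
  set v : ℤ → ℝ := fun k => (m k : ℝ) ^ (1 / p.toReal) with hv
  have hv0 : ∀ k, 0 < v k := fun k => Real.rpow_pos_of_pos (hm k) _
  have hwv : ∀ k, w (k + 1) * v (k + 1) = v k := fun k => by
    rw [hwm, add_sub_cancel_right, Real.div_rpow (m k).coe_nonneg (m (k + 1)).coe_nonneg, Complex.ofReal_div,
      div_mul_cancel₀ _ (Complex.ofReal_ne_zero.2 (hv0 (k + 1)).ne')]
  -- The extra `1` pays for the term `m j` of the right tail sum, as `u` takes its right-hand value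
  -- only from `j + 1` on.
  refine ⟨(2 * C.toNNReal) ^ p.toReal + 1, fun j => ?_⟩
  obtain ⟨y, hy, hyC⟩ := hC (lp.single p j 1)
  rw [lp.norm_single hp0, norm_one, mul_one, ← Real.coe_toNNReal C hC0.le] at hyC
  set u : ℤ → ℂ := fun k => y k / v k with hu
  have hyu : ∀ k, y k = v k * u k := fun k =>
    (mul_div_cancel₀ _ (Complex.ofReal_ne_zero.2 (hv0 k).ne')).symm
  have hrec : ∀ n, v n * (u n - u (n + 1)) = (lp.single p j (1 : ℂ) : lp (fun _ : ℤ => ℂ) p) n := by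
    intro n
    rw [← hy]
    change _ = y n - w (n + 1) * y (n + 1)
    rw [hyu, hyu, ← mul_assoc, hwv, mul_sub]
  have hne : ∀ n, n ≠ j → u n = u (n + 1) := fun n hn => by
    have := hrec n
    rw [lp.single_apply_ne _ _ _ hn, mul_eq_zero] at this
    exact sub_eq_zero.1 (this.resolve_left (Complex.ofReal_ne_zero.2 (hv0 n).ne'))
  have hleft : ∀ n : ℕ, u (j - n) = u j := fun n => by
    induction n with
    | zero => simp
    | succ n ih =>
      rw [hne _ (by omega), ← ih]
      congr 1
      push_cast
      ring
  have hright : ∀ n : ℕ, u (j + 1 + n) = u (j + 1) := fun n => by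
    induction n with
    | zero => simp
    | succ n ih =>
      rw [← ih, hne (j + 1 + n) (by omega)]
      congr 1
      push_cast
      ring
  have hjump : (1 : ℝ) ≤ v j * ‖u j‖ + v j * ‖u (j + 1)‖ := by
    have := hrec j
    rw [lp.single_apply_self] at this
    calc (1 : ℝ) = ‖(v j : ℂ) * (u j - u (j + 1))‖ := by rw [this, norm_one]
      _ ≤ v j * (‖u j‖ + ‖u (j + 1)‖) := by
        rw [norm_mul, Complex.norm_real, Real.norm_of_nonneg (hv0 j).le]
        exact mul_le_mul_of_nonneg_left (norm_sub_le _ _) (hv0 j).le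
      _ = _ := mul_add _ _ _
  rcases le_or_gt 1 (2 * (v j * ‖u j‖)) with hl | hl
  · left
    refine (tsum_le_of_norm_le_of_const_ratio hp hyC (e := fun n : ℕ => j - n)
      (fun a b hab => by simpa using hab) (c := u j) (fun n => ?_) hl).trans ?_
    · rw [hyu, hleft]
    · gcongr
      exact le_self_add
  · right
    have := tsum_le_of_norm_le_of_const_ratio hp hyC (e := fun n : ℕ => j + 1 + n)
      (fun a b hab => by simpa using hab) (c := u (j + 1)) (fun n => by rw [hyu, hright])
      (j := j) (by change 1 ≤ 2 * (v j * _); linarith)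
    rw [tsum_eq_zero_add' ENNReal.summable, ENNReal.coe_add, add_mul, ENNReal.coe_one, one_mul,
      add_comm]
    refine add_le_add (le_of_eq_of_le (tsum_congr fun n => ?_) this) (by simp)
    congr 2
    push_cast
    ring

end ShiftEstimates

/-! ### From levels to their measurable subsets -/

section Distortion

variable {X : Type*} {f : Equiv.Perm X}

theorem image_zpow_image (i j : ℤ) (B : Set X) :
    (f ^ i : Equiv.Perm X) '' ((f ^ j : Equiv.Perm X) '' B) = (f ^ (i + j) : Equiv.Perm X) '' B := by
  rw [image_image, zpow_add]
  rfl

variable [MeasurableSpace X] {μ : Measure X} {W : Set X}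

theorem measurable_zpow (h₁ : Measurable f) (h₂ : Measurable f.symm) (k : ℤ) :
    Measurable (f ^ k : Equiv.Perm X) := by
  cases k with
  | ofNat n =>
    rw [Int.ofNat_eq_natCast, zpow_natCast, Equiv.Perm.coe_pow]
    exact h₁.iterate n
  | negSucc n =>
    rw [zpow_negSucc, ← inv_pow, Equiv.Perm.coe_pow]
    exact h₂.iterate (n + 1)

theorem measurableSet_image_zpow (h₁ : Measurable f) (h₂ : Measurable f.symm) (k : ℤ) {B : Set X}
    (hB : MeasurableSet B) : MeasurableSet ((f ^ k : Equiv.Perm X) '' B) := by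
  have : (f ^ k : Equiv.Perm X) '' B = (f ^ (-k) : Equiv.Perm X) ⁻¹' B := by
    rw [zpow_neg, Equiv.Perm.inv_def, Equiv.image_eq_preimage_symm]
  rw [this]
  exact measurable_zpow h₁ h₂ _ hB

theorem IsCompositionSystem.measurable_symm (hf : IsCompositionSystem μ f) :
    Measurable f.symm := fun B hB => by
  rw [← Equiv.image_eq_preimage_symm]
  exact hf.measurableSet_image B hB

/-- Bounded distortion compares the effect of `f ^ i` on a subset of a level `f ^ j '' W` with
its effect on the whole level. -/
theorem measure_image_mul_le (h₁ : Measurable f) (h₂ : Measurable f.symm) (hW0 : μ W ≠ 0)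
    (hWtop : μ W ≠ ∞) {K : ℝ≥0} (hK0 : 0 < K)
    (hK : ∀ (k : ℤ) (B : Set X), MeasurableSet B → B ⊆ W →
      (K : ℝ≥0∞)⁻¹ * μ ((f ^ k) '' W) * μ B ≤ μ ((f ^ k) '' B) * μ W ∧
      μ ((f ^ k) '' B) * μ W ≤ K * μ ((f ^ k) '' W) * μ B)
    (i j : ℤ) {B : Set X} (hB : MeasurableSet B) (hBW : B ⊆ (f ^ j : Equiv.Perm X) '' W) :
    μ ((f ^ i) '' B) * μ ((f ^ j) '' W) ≤ (K ^ 2 : ℝ≥0) * μ ((f ^ (i + j)) '' W) * μ B := by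
  -- Pulled back to `W`, the set is compared with `W` twice: from above at time `i + j`, from below
  -- at time `j`. Each costs a factor `K`.
  set C : Set X := (f ^ (-j) : Equiv.Perm X) '' B with hC
  have hCB : (f ^ j : Equiv.Perm X) '' C = B := by
    rw [hC, image_zpow_image, add_neg_cancel, zpow_zero, Equiv.Perm.coe_one, image_id]
  have hCm : MeasurableSet C := measurableSet_image_zpow h₁ h₂ _ hB
  have hCW : C ⊆ W := by
    have := image_mono (f := (f ^ (-j) : Equiv.Perm X)) hBW
    rwa [image_zpow_image, neg_add_cancel, zpow_zero, Equiv.Perm.coe_one, image_id] at this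
  have e1 := (hK (i + j) C hCm hCW).2
  have e2 := (hK j C hCm hCW).1
  rw [← image_zpow_image, hCB] at e1
  rw [hCB] at e2
  have hKi : (K : ℝ≥0∞) * (K : ℝ≥0∞)⁻¹ = 1 :=
    ENNReal.mul_inv_cancel (by exact_mod_cast hK0.ne') ENNReal.coe_ne_top
  rw [← ENNReal.mul_le_mul_iff_left hW0 hWtop]
  calc μ ((f ^ i) '' B) * μ ((f ^ j) '' W) * μ W
      = (μ ((f ^ i) '' B) * μ W) * μ ((f ^ j) '' W) := by ring
    _ ≤ K * μ ((f ^ (i + j)) '' W) * μ C * μ ((f ^ j) '' W) := by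
        gcongr
    _ = K * μ ((f ^ (i + j)) '' W) * (K * (K : ℝ≥0∞)⁻¹) * μ C * μ ((f ^ j) '' W) := by
        rw [hKi, mul_one]
    _ = K * K * μ ((f ^ (i + j)) '' W) * ((K : ℝ≥0∞)⁻¹ * μ ((f ^ j) '' W) * μ C) := by ring
    _ ≤ K * K * μ ((f ^ (i + j)) '' W) * (μ B * μ W) := by gcongr
    _ = _ := by
        push_cast
        ring

/-- Growth bounds on the measures of the levels `f ^ j '' W`, `j ∈ J`, pass to all measurable
subsets of the union of these levels. -/
theorem measure_image_le_of_subset_iUnion (h₁ : Measurable f) (h₂ : Measurable f.symm)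
    (hWm : MeasurableSet W) (hW0 : ∀ j : ℤ, μ ((f ^ j) '' W) ≠ 0)
    (hWtop : ∀ j : ℤ, μ ((f ^ j) '' W) ≠ ∞)
    (hdisj : Pairwise (Disjoint on fun k : ℤ => (f ^ k) '' W)) {K : ℝ≥0} (hK0 : 0 < K)
    (hK : ∀ (k : ℤ) (B : Set X), MeasurableSet B → B ⊆ W →
      (K : ℝ≥0∞)⁻¹ * μ ((f ^ k) '' W) * μ B ≤ μ ((f ^ k) '' B) * μ W ∧
      μ ((f ^ k) '' B) * μ W ≤ K * μ ((f ^ k) '' W) * μ B)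
    {J : Set ℤ} {i : ℤ} {c : ℝ≥0}
    (hc : ∀ j ∈ J, μ ((f ^ (i + j)) '' W) ≤ c * μ ((f ^ j) '' W))
    {B : Set X} (hB : MeasurableSet B) (hBJ : B ⊆ ⋃ j ∈ J, (f ^ j : Equiv.Perm X) '' W) :
    μ ((f ^ i) '' B) ≤ (K ^ 2 * c : ℝ≥0) * μ B := by
  have hlevel : ∀ j : ℤ, MeasurableSet ((f ^ j : Equiv.Perm X) '' W) :=
    fun j => measurableSet_image_zpow h₁ h₂ j hWm
  have hBm : ∀ j : J, MeasurableSet (B ∩ (f ^ (j : ℤ) : Equiv.Perm X) '' W) :=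
    fun j => hB.inter (hlevel j)
  have hBeq : B = ⋃ j : J, B ∩ (f ^ (j : ℤ) : Equiv.Perm X) '' W := by
    rw [← inter_iUnion, iUnion_subtype, inter_eq_left.2 hBJ]
  have hpiece : ∀ j : J, μ ((f ^ i) '' (B ∩ (f ^ (j : ℤ) : Equiv.Perm X) '' W)) ≤
      (K ^ 2 * c : ℝ≥0) * μ (B ∩ (f ^ (j : ℤ) : Equiv.Perm X) '' W) := by
    intro j
    rw [← ENNReal.mul_le_mul_iff_left (hW0 j) (hWtop j)]
    have hW0' : μ W ≠ 0 := by simpa using hW0 0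
    have hWtop' : μ W ≠ ∞ := by simpa using hWtop 0
    refine (measure_image_mul_le h₁ h₂ hW0' hWtop' hK0 hK i j (hBm j) inter_subset_right).trans ?_
    calc _ ≤ (K ^ 2 : ℝ≥0) * (c * μ ((f ^ (j : ℤ)) '' W)) *
          μ (B ∩ (f ^ (j : ℤ) : Equiv.Perm X) '' W) := by
          gcongr
          exact hc j j.2
      _ = _ := by
        rw [ENNReal.coe_mul]
        ring
  calc μ ((f ^ i) '' B)
      = μ (⋃ j : J, (f ^ i) '' (B ∩ (f ^ (j : ℤ) : Equiv.Perm X) '' W)) := by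
        rw [← image_iUnion, ← hBeq]
    _ ≤ ∑' j : J, μ ((f ^ i) '' (B ∩ (f ^ (j : ℤ) : Equiv.Perm X) '' W)) := measure_iUnion_le _
    _ ≤ ∑' j : J, (K ^ 2 * c : ℝ≥0) * μ (B ∩ (f ^ (j : ℤ) : Equiv.Perm X) '' W) :=
        ENNReal.tsum_le_tsum hpiece
    _ = (K ^ 2 * c : ℝ≥0) * μ B := by
        conv_rhs => rw [hBeq]
        rw [ENNReal.tsum_mul_left, measure_iUnion (fun a b hab => ?_) hBm]
        exact (hdisj (Subtype.coe_injective.ne hab)).mono inter_subset_right inter_subset_right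

end Distortion

/-! ### Restriction operators and powers of the composition operator -/

section Restriction

variable {X : Type*} [MeasurableSpace X] (p : ℝ≥0∞) {μ : Measure X}

theorem memLp_indicator {S : Set X} (hS : MeasurableSet S) (g : Lp ℂ p μ) :
    MemLp (S.indicator (g : X → ℂ)) p μ :=
  (Lp.memLp g).indicator hS

variable [Fact (1 ≤ p)]

/-- Multiplication by the indicator function of a measurable set, as an operator on `L^p`. -/
noncomputable def indicatorOperator {S : Set X} (hS : MeasurableSet S) : Lp ℂ p μ →L[ℂ] Lp ℂ p μ :=
  LinearMap.mkContinuous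
    { toFun := fun g => (memLp_indicator p hS g).toLp
      map_add' := fun g₁ g₂ => by
        rw [← MemLp.toLp_add, MemLp.toLp_eq_toLp_iff, ← indicator_add']
        filter_upwards [Lp.coeFn_add g₁ g₂] with x hx
        simp only [indicator, hx]
      map_smul' := fun a g => by
        rw [RingHom.id_apply, ← MemLp.toLp_const_smul, MemLp.toLp_eq_toLp_iff]
        filter_upwards [Lp.coeFn_smul a g] with x hx
        simp only [indicator, hx, Pi.smul_apply, smul_ite, smul_zero] }
    1 (fun g => by
      rw [one_mul, Lp.norm_def g]
      exact (Lp.norm_toLp _ (memLp_indicator p hS g)).trans_le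
        (ENNReal.toReal_mono (Lp.memLp g).2.ne (eLpNorm_indicator_le _)))

theorem indicatorOperator_coeFn {S : Set X} (hS : MeasurableSet S) (g : Lp ℂ p μ) :
    indicatorOperator p hS g =ᵐ[μ] S.indicator (g : X → ℂ) :=
  MemLp.coeFn_toLp (memLp_indicator p hS g)

theorem indicatorOperator_compl {S : Set X} (hS : MeasurableSet S) :
    indicatorOperator p (μ := μ) hS.compl = 1 - indicatorOperator p hS := by
  ext1 g
  refine Lp.ext ?_
  rw [_root_.sub_apply, one_apply_eq_self]
  filter_upwards [indicatorOperator_coeFn p hS g, indicatorOperator_coeFn p hS.compl g,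
    Lp.coeFn_sub g (indicatorOperator p hS g)] with x h1 h2 h3
  rw [h3, h2, Pi.sub_apply, h1, indicator_compl, Pi.sub_apply]

variable {f : X → X}

theorem compositionOperator_pow_coeFn (hf : IsCompositionSystem μ f) (k : ℕ) (g : Lp ℂ p μ) :
    (compositionOperator p hf ^ k) g =ᵐ[μ] g ∘ f^[k] := by
  induction k with
  | zero => rfl
  | succ k ih =>
    rw [pow_succ', mul_apply_eq_comp, iterate_succ, ← comp_assoc]
    exact (compositionOperator_coeFn p hf _).trans (hf.quasiMeasurePreserving.ae_eq_comp ih)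

/-- If `f ^ k` expands preimages of subsets of `S` by at most the factor `c`, then `T_f ^ k` has
norm at most `c ^ (1 / p)` on functions supported in `S`. -/
theorem norm_compositionOperator_pow_comp_indicator_le (hf : IsCompositionSystem μ f) (k : ℕ)
    {S : Set X} (hS : MeasurableSet S) {c : ℝ≥0}
    (hc : ∀ B, MeasurableSet B → B ⊆ S → μ (f^[k] ⁻¹' B) ≤ c * μ B) :
    ‖(compositionOperator p hf ^ k) ∘L indicatorOperator p hS‖ ≤ (c : ℝ) ^ (1 / p).toReal := by
  refine ContinuousLinearMap.opNorm_le_bound _ (by positivity) fun g => ?_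
  have hfk : Measure.QuasiMeasurePreserving f^[k] μ μ := hf.quasiMeasurePreserving.iterate k
  -- After the change of variables only the image measure on `S` matters.
  have hmeas : (μ.map f^[k]).restrict S ≤ (c : ℝ≥0∞) • μ := by
    refine Measure.le_iff.2 fun B hB => ?_
    rw [Measure.restrict_apply hB, Measure.map_apply hfk.measurable (hB.inter hS)]
    refine (hc _ (hB.inter hS) inter_subset_right).trans ?_
    rw [Measure.smul_apply, smul_eq_mul]
    gcongr
    exact inter_subset_left
  have hae : ((compositionOperator p hf ^ k) ∘L indicatorOperator p hS) g =ᵐ[μ]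
      S.indicator g ∘ f^[k] :=
    (compositionOperator_pow_coeFn p hf k _).trans
      (hfk.ae_eq_comp (indicatorOperator_coeFn p hS g))
  have key : eLpNorm (((compositionOperator p hf ^ k) ∘L indicatorOperator p hS) g) p μ ≤
      (c : ℝ≥0∞) ^ (1 / p).toReal * eLpNorm g p μ := by
    rw [eLpNorm_congr_ae hae, ← eLpNorm_map_measure
      (((Lp.aestronglyMeasurable g).indicator hS).mono_ac hfk.absolutelyContinuous)
      hfk.measurable.aemeasurable, eLpNorm_indicator_eq_eLpNorm_restrict hS]
    exact (eLpNorm_mono_measure g hmeas).trans (eLpNorm_smul_measure_le _ g p μ)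
  have hfin : (c : ℝ≥0∞) ^ (1 / p).toReal ≠ ∞ := by simp
  rw [Lp.norm_def, Lp.norm_def]
  refine (ENNReal.toReal_mono (ENNReal.mul_ne_top hfin (Lp.memLp g).2.ne) key).trans_eq ?_
  rw [ENNReal.toReal_mul, ← ENNReal.toReal_rpow, ENNReal.coe_toReal]

end Restriction

/-! ### Dissipative systems and the hyperbolic splitting -/

section Dissipative

variable {X : Type*} [MeasurableSpace X] {μ : Measure X} {f : Equiv.Perm X} {W : Set X}

theorem IsDissipativeSystem.measure_image_ne_zero (hf : IsCompositionSystem μ f)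
    (hW : IsDissipativeSystem μ f W) (k : ℤ) : μ ((f ^ k) '' W) ≠ 0 := by
  have step : ∀ k : ℤ, μ ((f ^ k) '' W) = 0 ↔ μ ((f ^ (k + 1)) '' W) = 0 := fun k => by
    rw [← hW.nonsingular _ (measurableSet_image_zpow hf.measurable hf.measurable_symm (k + 1)
      hW.measurableSet), add_comm k 1, ← image_zpow_image, zpow_one, preimage_image_eq _ f.injective]
  induction k with
  | zero => simpa using hW.measure_pos.ne'
  | succ k ih => rwa [Ne, ← step]
  | pred k ih => rwa [Ne, step, sub_add_cancel]

/-- A quotient by `∞` is `0` in `ℝ≥0∞`, so a level of infinite measure would give a zero weight,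
which invertibility of the shift excludes. -/
theorem measure_image_ne_top_of_systemWeight_ne_zero {p : ℝ≥0∞} (hp0 : 0 < p.toReal) {k : ℤ}
    (h : systemWeight p μ f W k ≠ 0) : μ ((f ^ k) '' W) ≠ ∞ := fun htop => h <| by
  rw [systemWeight, htop, ENNReal.div_top, ENNReal.toReal_zero,
    Real.zero_rpow (one_div_pos.2 hp0).ne', Complex.ofReal_zero]

theorem measure_image_le_of_one_le_systemWeight {p : ℝ≥0∞} (hp0 : 0 < p.toReal) {m : ℤ → ℝ≥0}
    (hm : ∀ k, (m k : ℝ≥0∞) = μ ((f ^ k) '' W)) (hm0 : ∀ k, 0 < m k) {N : ℝ≥0} {k : ℤ}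
    (h : 1 ≤ N * ‖systemWeight p μ f W k‖) :
    μ ((f ^ k) '' W) ≤ (N ^ p.toReal : ℝ≥0) * μ ((f ^ (k - 1)) '' W) := by
  rw [← hm, ← hm, ← ENNReal.coe_mul, ENNReal.coe_le_coe, ← NNReal.coe_le_coe]
  rw [systemWeight, Complex.norm_real, Real.norm_of_nonneg (by positivity), ← hm, ← hm,
    ENNReal.toReal_div, ENNReal.coe_toReal, ENNReal.coe_toReal] at h
  have h1 := Real.one_le_rpow h hp0.le
  rw [Real.mul_rpow N.coe_nonneg (by positivity), one_div, Real.rpow_inv_rpow (by positivity)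
    hp0.ne', ← mul_div_assoc, one_le_div (by exact_mod_cast hm0 k)] at h1
  push_cast
  exact h1

theorem IsCompositionSystem.symm (hf : IsCompositionSystem μ f) {c : ℝ≥0}
    (hc : ∀ B, MeasurableSet B → μ (f '' B) ≤ c * μ B) : IsCompositionSystem μ f.symm where
  sigmaFinite := hf.sigmaFinite
  injective := f.symm.injective
  measurable := hf.measurable_symm
  measurableSet_image B hB := by
    rw [Equiv.image_symm_eq_preimage]
    exact hf.measurable hB
  exists_bound := by
    refine ⟨c + 1, by positivity, fun B hB => ?_⟩
    rw [← Equiv.image_eq_preimage_symm]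
    refine (hc B hB).trans ?_
    gcongr
    exact le_self_add

theorem compositionOperator_leftInverse (p : ℝ≥0∞) [Fact (1 ≤ p)] {f g : X → X}
    (hf : IsCompositionSystem μ f) (hg : IsCompositionSystem μ g) (h : LeftInverse f g) :
    LeftInverse (compositionOperator p hg) (compositionOperator p hf) := fun φ => by
  refine Lp.ext ((compositionOperator_coeFn p hg _).trans
    ((hg.quasiMeasurePreserving.ae_eq_comp (compositionOperator_coeFn p hf φ)).trans ?_))
  rw [comp_assoc, h.comp_eq_id, comp_id]

/-- An invertible composition operator for which `X` splits into a part where `f⁻ᵏ` contracts the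
measure geometrically and a part where `fᵏ` does is strongly structurally stable. -/
theorem stronglyStructurallyStable_compositionOperator {p : ℝ≥0∞} [Fact (1 ≤ p)] (hp : p ≠ ∞)
    (hf : IsCompositionSystem μ f) (hg : IsCompositionSystem μ f.symm) {S : Set X}
    (hS : MeasurableSet S) {D θ : ℝ≥0} (hθ : θ < 1)
    (h₁ : ∀ k : ℕ, ∀ B, MeasurableSet B → B ⊆ S → μ (f^[k] ⁻¹' B) ≤ (D * θ ^ k : ℝ≥0) * μ B)
    (h₂ : ∀ k : ℕ, ∀ B, MeasurableSet B → B ⊆ Sᶜ →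
      μ (f.symm^[k] ⁻¹' B) ≤ (D * θ ^ k : ℝ≥0) * μ B) :
    StronglyStructurallyStable (compositionOperator p hf) := by
  have hr : 0 < (1 / p).toReal :=
    ENNReal.toReal_pos (by simpa using hp) (by simpa using (zero_lt_one.trans_le Fact.out).ne')
  have hsum : Summable fun k : ℕ => ((D * θ ^ k : ℝ≥0) : ℝ) ^ (1 / p).toReal := by
    have : ∀ k : ℕ, ((D * θ ^ k : ℝ≥0) : ℝ) ^ (1 / p).toReal =
        (D : ℝ) ^ (1 / p).toReal * ((θ : ℝ) ^ (1 / p).toReal) ^ k := fun k => by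
      push_cast
      rw [Real.mul_rpow D.coe_nonneg (by positivity), Real.rpow_pow_comm θ.coe_nonneg]
    simp only [this]
    exact (summable_geometric_of_lt_one (by positivity)
      (Real.rpow_lt_one θ.coe_nonneg hθ hr)).mul_left _
  set T := compositionOperator p hf
  set T' := compositionOperator p hg
  have hl : LeftInverse T' T := compositionOperator_leftInverse p hf hg f.right_inv
  have hr' : RightInverse T' T := compositionOperator_leftInverse p hg hf f.left_inv
  have hTT' : T * T' = 1 := ContinuousLinearMap.ext hr'
  have hA : Summable fun k : ℕ => ‖(T ^ k) ∘L indicatorOperator p hS‖ :=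
    .of_nonneg_of_le (fun k => norm_nonneg _)
      (fun k => norm_compositionOperator_pow_comp_indicator_le p hf k hS (h₁ k)) hsum
  -- The exponent `k + 1` makes `T * B 0` equal to `1 - P`, complementing `A 0 = P`.
  have hB : Summable fun k : ℕ => ‖(T' ^ (k + 1)) ∘L indicatorOperator p hS.compl‖ :=
    (summable_nat_add_iff 1).2 (.of_nonneg_of_le (fun k => norm_nonneg _)
      (fun k => norm_compositionOperator_pow_comp_indicator_le p hg k hS.compl (h₂ k)) hsum)
  refine stronglyStructurallyStable_of_summable hA hB
    (ContinuousLinearEquiv.equivOfInverse T T' hl hr') (fun k => ?_) (fun k => ?_) ?_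
  · change T * (T ^ k * _) = T ^ (k + 1) * _
    rw [← mul_assoc, ← pow_succ']
  · change T * (T' ^ (k + 1 + 1) * _) = T' ^ (k + 1) * _
    rw [← mul_assoc, pow_succ' T' (k + 1), ← mul_assoc, hTT', one_mul]
  · change T ^ 0 * _ + T * (T' ^ (0 + 1) * _) = 1
    rw [← mul_assoc, zero_add, pow_one, hTT', pow_zero, one_mul, one_mul, indicatorOperator_compl p hS,
      add_sub_cancel]

end Dissipative

/-! ### Transfer from the shift to the composition operator -/

theorem theoremW {X : Type*} [MeasurableSpace X] (μ : Measure X) (f : Equiv.Perm X) (W : Set X)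
    (p : ℝ≥0∞) [Fact (1 ≤ p)] (hp : p ≠ ∞)
    (hf : IsCompositionSystem μ f) (hW : IsDissipativeSystem μ f W)
    (hK : HasBoundedDistortion μ f W)
    (hB : StronglyStructurallyStable
      (weightedShift p hp (systemWeight p μ f W) (systemWeight_bounded p hf hW))) :
    StronglyStructurallyStable (compositionOperator p hf) := by
  have hp0 : 0 < p.toReal := ENNReal.toReal_pos (zero_lt_one.trans_le Fact.out).ne' hp
  obtain ⟨K, hK0, hK⟩ := hK
  obtain ⟨N, hN⟩ := exists_one_le_mul_norm_weight hp _ hB.1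
  have hN0 : 0 ≤ N := by
    by_contra! h
    linarith [hN 0, mul_nonpos_of_nonpos_of_nonneg h.le (norm_nonneg (systemWeight p μ f W 0))]
  lift N to ℝ≥0 using hN0
  have hμ0 := hW.measure_image_ne_zero hf
  have hμtop : ∀ k : ℤ, μ ((f ^ k) '' W) ≠ ∞ := fun k =>
    measure_image_ne_top_of_systemWeight_ne_zero hp0 fun h => by
      have := hN k
      rw [h, norm_zero, mul_zero] at this
      exact not_lt_of_ge this one_pos
  set m : ℤ → ℝ≥0 := fun k => (μ ((f ^ k) '' W)).toNNReal
  have hmμ : ∀ k, (m k : ℝ≥0∞) = μ ((f ^ k) '' W) := fun k => ENNReal.coe_toNNReal (hμtop k)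
  have hm0 : ∀ k, 0 < m k := fun k => ENNReal.toNNReal_pos (hμ0 k) (hμtop k)
  have hS := hf.measurable_symm
  have himage {J : Set ℤ} {i : ℤ} {c : ℝ≥0}
      (hc : ∀ j ∈ J, μ ((f ^ (i + j)) '' W) ≤ c * μ ((f ^ j) '' W)) {B : Set X}
      (hB : MeasurableSet B) (hBJ : B ⊆ ⋃ j ∈ J, (f ^ j : Equiv.Perm X) '' W) :=
    measure_image_le_of_subset_iUnion hf.measurable hS hW.measurableSet hμ0 hμtop
      hW.pairwise_disjoint hK0 hK hc hB hBJ
  -- The lower bound on the weights gives `m (j + 1) ≤ N^p m j`; distortion extends this to all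
  -- measurable sets, so composition with `f.symm` is bounded.
  have hg : IsCompositionSystem μ f.symm := by
    refine hf.symm (c := K ^ 2 * N ^ p.toReal) fun B hB => ?_
    have := himage (J := univ) (i := 1) (c := N ^ p.toReal) (fun j _ => ?_) hB
      (by rw [biUnion_univ, hW.iUnion_eq]; exact subset_univ B)
    · rwa [zpow_one] at this
    · have := measure_image_le_of_one_le_systemWeight hp0 hmμ hm0 (hN (1 + j))
      rwa [add_sub_cancel_left] at this
  obtain ⟨C, hC⟩ := exists_tsum_le_of_surjective_one_sub hp _ hm0 (fun k => by
    rw [systemWeight, ← hmμ, ← hmμ, ENNReal.toReal_div, ENNReal.coe_toReal, ENNReal.coe_toReal])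
    hB.surjective_one_sub
  obtain ⟨J, D, θ, hθ, hJ, hJc⟩ := exists_dichotomy_of_tsum_le
    (m := fun k => (m k : ℝ≥0∞)) (fun _ => ENNReal.coe_ne_top) hC
  simp only [hmμ] at hJ hJc
  -- Preimages under `f^k` move level `j` to level `j - k`, so the set of left decay is where
  -- forward powers of `T_f` contract.
  refine stronglyStructurallyStable_compositionOperator hp hf hg
    (S := ⋃ j ∈ J, (f ^ j : Equiv.Perm X) '' W) (D := K ^ 2 * D)
    (.biUnion J.to_countable fun j _ =>
      measurableSet_image_zpow hf.measurable hS j hW.measurableSet) hθ ?_ ?_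
  · intro k B hBm hBS
    have := himage (i := -k) (c := D * θ ^ k) (fun j hj => ?_) hBm hBS
    · rwa [← mul_assoc, zpow_neg, zpow_natCast, Equiv.Perm.inv_def, Equiv.image_symm_eq_preimage,
        Equiv.Perm.coe_pow] at this
    · rw [neg_add_eq_sub]
      exact hJ j hj k
  · intro k B hBm hBS
    have := himage (J := Jᶜ) (i := k) (c := D * θ ^ k) (fun j hj => ?_) hBm fun x hx => ?_
    · rwa [← mul_assoc, ← inv_inv (f ^ (k : ℤ)), Equiv.Perm.inv_def, Equiv.image_symm_eq_preimage,
        zpow_natCast, ← inv_pow, Equiv.Perm.coe_pow] at this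
    · rw [add_comm]
      exact hJc j hj k
    · obtain ⟨j, hj⟩ := mem_iUnion.1 (hW.iUnion_eq ▸ mem_univ x)
      refine mem_biUnion (fun hjJ => hBS hx (mem_biUnion hjJ hj)) hj
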